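/- **Setting.** Let $S$ be a nonempty Borel space (a Borel subset of a Polish space, with its Borel $\sigma$-algebra $\mathcal B(S)$). A homogeneous (conservative, stable) $Q$-function on $S$ is a real-valued signed kernel $q(dy|x)$ on $\mathcal B(S)$ from $S$ such that $q(\Gamma|x)\ge 0$ whenever $x\notin\Gamma\in\mathcal B(S)$, and $q(S|x)=0$ for all $x\in S$. Put $q_x:=-q(\{x\}|x)\in[0,\infty)$ and $\tilde q(\Gamma|x):=q(\Gamma\setminus\{x\}|x)$. The associated (minimal) homogeneous Markov pure jump process is described by its successive states and sojourn times $(x_0,\theta_1,x_1,\theta_2,\dots)$, with a cemetery state $x_\infty\notin S$. Under its law $\mathbb P^q_x$, one has $x_0=x$, and given $(x_0,\theta_1,\dots,\theta_n,x_n)$: if $x_n=y\in S$ and $q_y>0$, then $\theta_{n+1}$ and $x_{n+1}$ are independent, $\theta_{n+1}$ is exponential with parameter $q_y$ and $x_{n+1}$ has law $\tilde q(\cdot|y)/q_y$; if $x_n=y\in S$ and $q_y=0$, or if $x_n=x_\infty$, then $\theta_{n+1}=\infty$ and $x_{n+1}=x_\infty$. Let $t_\infty:=\sum_{n\ge1}\theta_n$.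 The process is called nonexplosive if $\mathbb P^q_x(t_\infty=\infty)=1$ for all $x\in S$, and explosive if $\mathbb P^q_x(t_\infty=\infty)<1$ for some $x\in S$. **Chen's condition.** There exist a nondecreasing sequence of sets $S_n\in\mathcal B(S)$ and a measurable function $V:S\to[0,\infty)$ such that $\bigcup_n S_n=S$; $\sup_{x\in S_n}q_x<\infty$ for each $n$; $\inf_{x\in S\setminus S_n}V(x)\uparrow\infty$ as $n\to\infty$ (with $\inf\emptyset=\infty$); and, for some constant $\alpha\in(0,\infty)$, $\int_S V(y)\,q(dy|x)\le\alpha V(x)$ for all $x\in S$ (in particular, these integrals are finite). **Theorem.** Let $q$ be a homogeneous $Q$-function on $S$. (a) If Chen's condition holds, then the process is nonexplosive. (b) Suppose that $S$ is a locally compact separable metric space and that the functions $x\mapsto q_x$ and $x\mapsto\int_S f(y)\,q(dy|x)$ are continuous on $S$, for every bounded continuous function $f$ on $S$. If the process is nonexplosive, then Chen's condition holds, where moreover the sets $S_n$ can be taken compact and such that $\sup_{x\in S_n}V(x)<\infty$ for every $n$. (c) The process is nonexplosive if and only if, for each $\alpha\in(0,\infty)$, there is no measurable function $U:S\to[0,1]$,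 not identically zero, satisfying $\alpha U(x)=\int_S U(y)\,q(dy|x)$ for all $x\in S$. (d) The process is explosive if and only if there exist a bounded nonnegative measurable function $U$ on $S$, not identically zero, and some $\alpha>0$ such that $\alpha U(x)\le\int_S U(y)\,q(dy|x)$ for all $x\in S$. -/

import Mathlib

open MeasureTheory ProbabilityTheory Filter Topology Set
open scoped ENNReal BoundedContinuousFunction

noncomputable section

/-- A homogeneous (conservative, stable) `Q`-function on a measurable space `S`: a signed kernel
`q(dy|x)` from `S` to `S` which is nonnegative and finite off the diagonal and has total mass zero.
Finiteness, hence stability, is built into `SignedMeasure`, whose values are real numbers. -/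
structure HomQFunction (S : Type*) [MeasurableSpace S] where
  /-- the signed measure `q(dy|x)` -/
  toFun : S → SignedMeasure S
  measurable_toFun : ∀ Γ : Set S, MeasurableSet Γ → Measurable fun x => toFun x Γ
  nonneg_of_notMem : ∀ (x : S) (Γ : Set S), MeasurableSet Γ → x ∉ Γ → 0 ≤ toFun x Γ
  conservative : ∀ x : S, toFun x univ = 0

namespace HomQFunction

variable {S : Type*} [MeasurableSpace S]

instance : CoeFun (HomQFunction S) fun _ => S → SignedMeasure S := ⟨toFun⟩

/-- The total jump rate `q_x = -q({x}|x)` out of the state `x`. -/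
def rate (q : HomQFunction S) (x : S) : ℝ := -(q x {x})

/-- The value of `q(dy|x)` at the section at `x` of a measurable subset of `S × S` is measurable
in `x`. -/
theorem measurable_section [StandardBorelSpace S] (q : HomQFunction S) {D : Set (S × S)}
    (hD : MeasurableSet D) : Measurable fun x => q x (Prod.mk x ⁻¹' D) := by
  induction D, hD using MeasurableSpace.induction_on_inter generateFrom_prod.symm
    isPiSystem_prod with
  | empty => simp
  | basic t ht =>
    obtain ⟨A, hA, B, hB, rfl⟩ := ht
    have : (fun x => q x (Prod.mk x ⁻¹' A ×ˢ B)) = A.indicator (fun x => q x B) := by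
      ext x
      by_cases hx : x ∈ A <;> simp [hx, mk_preimage_prod_right, mk_preimage_prod_right_eq_empty]
    rw [this]
    exact (q.measurable_toFun B hB).indicator hA
  | compl t ht ih =>
    have : (fun x => q x (Prod.mk x ⁻¹' tᶜ)) = fun x => q x univ - q x (Prod.mk x ⁻¹' t) := by
      ext x
      have h := VectorMeasure.of_add_of_sdiff (v := q x) (measurable_prodMk_left (x := x) ht)
        MeasurableSet.univ (subset_univ _)
      rw [preimage_compl, compl_eq_univ_sdiff]
      linarith
    rw [this]
    exact (q.measurable_toFun _ MeasurableSet.univ).sub ih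
  | iUnion f hd hf ih =>
    have : ∀ x, HasSum (fun n => q x (Prod.mk x ⁻¹' f n)) (q x (Prod.mk x ⁻¹' ⋃ n, f n)) := by
      intro x
      rw [preimage_iUnion]
      exact (q x).m_iUnion (fun n => measurable_prodMk_left (hf n))
        (fun i j hij => (hd hij).preimage _)
    refine measurable_of_tendsto_metrizable (f := fun n x =>
      ∑ i ∈ Finset.range n, q x (Prod.mk x ⁻¹' f i))
      (fun n => Finset.measurable_sum _ fun i _ => ih i) ?_
    rw [tendsto_pi_nhds]
    exact fun x => (this x).tendsto_sum_nat

theorem measurable_apply_diff [StandardBorelSpace S] (q : HomQFunction S) {Γ : Set S}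
    (hΓ : MeasurableSet Γ) : Measurable fun x => q x (Γ \ {x}) := by
  have h := q.measurable_section (D := (univ ×ˢ Γ) ∩ (diagonal S)ᶜ)
    ((MeasurableSet.univ.prod hΓ).inter measurableSet_diagonal.compl)
  convert h using 3 with x
  ext y
  simp [eq_comm]

theorem rate_eq [MeasurableSingletonClass S] (q : HomQFunction S) (x : S) :
    q.rate x = q x {x}ᶜ := by
  have h := VectorMeasure.of_add_of_sdiff (v := q x) (measurableSet_singleton x)
    MeasurableSet.univ (subset_univ _)
  rw [q.conservative, ← compl_eq_univ_sdiff] at h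
  rw [rate]
  linarith

theorem measurable_rate [StandardBorelSpace S] (q : HomQFunction S) : Measurable q.rate := by
  have h := q.measurable_apply_diff MeasurableSet.univ
  convert h using 2 with x
  rw [rate_eq, compl_eq_univ_sdiff]

theorem rate_nonneg [MeasurableSingletonClass S] (q : HomQFunction S) (x : S) : 0 ≤ q.rate x := by
  rw [rate_eq]
  exact q.nonneg_of_notMem x _ (measurableSet_singleton x).compl (by simp)

theorem zero_le_restrict [MeasurableSingletonClass S] (q : HomQFunction S) (x : S) :
    0 ≤[{x}ᶜ] q x :=
  VectorMeasure.restrict_le_restrict_of_subset_le _ _ fun Γ hΓ h =>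
    q.nonneg_of_notMem x Γ hΓ fun hx => h hx rfl

/-- The jump measure `q̃(Γ|x) = q(Γ \ {x}|x)`. -/
def jumpMeasure [MeasurableSingletonClass S] (q : HomQFunction S) (x : S) : Measure S :=
  (q x).toMeasureOfZeroLE {x}ᶜ (measurableSet_singleton x).compl (q.zero_le_restrict x)

instance [MeasurableSingletonClass S] (q : HomQFunction S) (x : S) :
    IsFiniteMeasure (q.jumpMeasure x) := by
  unfold jumpMeasure; infer_instance

theorem jumpMeasure_apply [MeasurableSingletonClass S] (q : HomQFunction S) (x : S) {Γ : Set S}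
    (hΓ : MeasurableSet Γ) : q.jumpMeasure x Γ = ENNReal.ofReal (q x (Γ \ {x})) := by
  have h := SignedMeasure.toMeasureOfZeroLE_real_apply (q x) (q.zero_le_restrict x)
    (measurableSet_singleton x).compl hΓ
  rw [← ofReal_measureReal (μ := q.jumpMeasure x), jumpMeasure, h, inter_comm, sdiff_eq]

theorem jumpMeasure_univ [MeasurableSingletonClass S] (q : HomQFunction S) (x : S) :
    q.jumpMeasure x univ = ENNReal.ofReal (q.rate x) := by
  rw [jumpMeasure_apply q x MeasurableSet.univ, rate_eq, compl_eq_univ_sdiff]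

theorem measurable_jumpMeasure [StandardBorelSpace S] (q : HomQFunction S) :
    Measurable q.jumpMeasure := by
  refine Measure.measurable_of_measurable_coe _ fun Γ hΓ => ?_
  simp_rw [q.jumpMeasure_apply _ hΓ]
  exact (q.measurable_apply_diff hΓ).ennreal_ofReal

theorem measurable_expMeasure : Measurable fun r : ℝ => expMeasure r := by
  refine Measure.measurable_of_measurable_coe _ fun A hA => ?_
  have h : ∀ r, expMeasure r A = ∫⁻ t in A, exponentialPDF r t := fun r => by
    rw [expMeasure, gammaMeasure, withDensity_apply _ hA]; rfl
  simp_rw [h]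
  refine Measurable.lintegral_prod_right' (f := fun p : ℝ × ℝ => exponentialPDF p.1 p.2) ?_
  simp_rw [exponentialPDF_eq]
  refine (Measurable.ite (measurableSet_le measurable_const measurable_snd) ?_
    measurable_const).ennreal_ofReal
  fun_prop

/-- The law of the sojourn time in the state `x`: exponential with parameter `q_x` if `q_x ≠ 0`,
and the Dirac mass at `∞` if `q_x = 0`. -/
def sojourn [StandardBorelSpace S] (q : HomQFunction S) : Kernel S ℝ≥0∞ := by
  classical
  exact
  { toFun := fun x => if q.rate x = 0 then Measure.dirac ∞
      else (expMeasure (q.rate x)).map ENNReal.ofReal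
    measurable' := Measurable.ite (q.measurable_rate (measurableSet_singleton 0)) measurable_const
      ((Measure.measurable_map _ ENNReal.measurable_ofReal).comp
        (measurable_expMeasure.comp q.measurable_rate)) }

/-- The law of the state after the sojourn in `x`, where `Sum.inr ()` is the cemetery `x_∞`:
the normalized jump measure `q̃(dy|x) / q_x` if `q_x ≠ 0`, and the Dirac mass at `x_∞`
if `q_x = 0`. -/
def postJump [StandardBorelSpace S] (q : HomQFunction S) : Kernel S (S ⊕ Unit) := by
  classical
  exact
  { toFun := fun x => if q.rate x = 0 then Measure.dirac (Sum.inr ())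
      else (ENNReal.ofReal (q.rate x))⁻¹ • (q.jumpMeasure x).map Sum.inl
    measurable' := by
      refine Measurable.ite (q.measurable_rate (measurableSet_singleton 0)) measurable_const ?_
      refine Measure.measurable_of_measurable_coe _ fun A hA => ?_
      simp only [Measure.smul_apply, smul_eq_mul]
      refine q.measurable_rate.ennreal_ofReal.inv.mul ?_
      exact (Measure.measurable_coe hA).comp
        ((Measure.measurable_map _ measurable_inl).comp q.measurable_jumpMeasure) }

instance [StandardBorelSpace S] (q : HomQFunction S) : IsMarkovKernel q.sojourn := by
  refine ⟨fun x => ?_⟩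
  by_cases h : q.rate x = 0
  · simp only [sojourn, Kernel.coe_mk, h, if_true]; infer_instance
  · simp only [sojourn, Kernel.coe_mk, h, if_false]
    have := isProbabilityMeasure_expMeasure ((q.rate_nonneg x).lt_of_ne' h)
    exact Measure.isProbabilityMeasure_map ENNReal.measurable_ofReal.aemeasurable

instance [StandardBorelSpace S] (q : HomQFunction S) : IsMarkovKernel q.postJump := by
  refine ⟨fun x => ?_⟩
  by_cases h : q.rate x = 0
  · simp only [postJump, Kernel.coe_mk, h, if_true]; infer_instance
  · simp only [postJump, Kernel.coe_mk, h, if_false]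
    have hpos := (q.rate_nonneg x).lt_of_ne' h
    refine ⟨?_⟩
    rw [Measure.smul_apply, Measure.map_apply measurable_inl MeasurableSet.univ, preimage_univ,
      jumpMeasure_univ, smul_eq_mul, ENNReal.inv_mul_cancel (by simpa using hpos) (by simp)]

/-- The transition kernel of the chain `(x_n, θ_n) ↦ (x_{n+1}, θ_{n+1})`: given `x_n = x ∈ S`, the
next state and the sojourn time `θ_{n+1}` in `x` are independent with the laws above, that is,
`P(θ_{n+1} ∈ dt, x_{n+1} ∈ dy | x_n = x) = e^{-q_x t} q̃(dy|x) dt` on `(0,∞) × S`, with the remaining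
mass (if any) at `θ_{n+1} = ∞`, `x_{n+1} = x_∞`. The cemetery is absorbing, with `θ_{n+1} = ∞`. -/
def step [StandardBorelSpace S] (q : HomQFunction S) :
    Kernel ((S ⊕ Unit) × ℝ≥0∞) ((S ⊕ Unit) × ℝ≥0∞) where
  toFun p := Sum.elim (q.postJump ×ₖ q.sojourn)
    (fun _ => Measure.dirac (Sum.inr (), ∞)) p.1
  measurable' := ((q.postJump ×ₖ q.sojourn).measurable.sumElim measurable_const).comp measurable_fst

instance [StandardBorelSpace S] (q : HomQFunction S) : IsMarkovKernel q.step := by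
  refine ⟨fun p => ?_⟩
  obtain ⟨x | u, t⟩ := p
  · exact inferInstanceAs (IsProbabilityMeasure ((q.postJump ×ₖ q.sojourn) x))
  · exact inferInstanceAs (IsProbabilityMeasure (Measure.dirac _))

/-- The law `P_x^q` of the marked point process started at `x`, as a measure on the canonical space
of the sequences `n ↦ (x_n, θ_n)`. Here `x_0 = x`, and `θ_0 = 0` is a dummy coordinate. -/
def pathLaw [StandardBorelSpace S] (q : HomQFunction S) (x : S) :
    Measure (ℕ → (S ⊕ Unit) × ℝ≥0∞) :=
  Kernel.traj (X := fun _ => (S ⊕ Unit) × ℝ≥0∞)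
    (fun n => q.step.comap (fun h => h ⟨n, Finset.mem_Iic.2 le_rfl⟩) (measurable_pi_apply _)) 0
    (fun _ => (Sum.inl x, 0))

/-- The explosion time `t_∞ = θ_1 + θ_2 + ⋯`. -/
def explosionTime (ω : ℕ → (S ⊕ Unit) × ℝ≥0∞) : ℝ≥0∞ := ∑' n, (ω (n + 1)).2

/-- The pure jump process with `Q`-function `q` is nonexplosive if `P_x^q(t_∞ = ∞) = 1` for all
`x`. -/
def Nonexplosive [StandardBorelSpace S] (q : HomQFunction S) : Prop :=
  ∀ x, q.pathLaw x {ω | explosionTime ω = ∞} = 1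

/-- The pure jump process with `Q`-function `q` is explosive if `P_x^q(t_∞ = ∞) < 1` for some
`x`. -/
def Explosive [StandardBorelSpace S] (q : HomQFunction S) : Prop :=
  ∃ x, q.pathLaw x {ω | explosionTime ω = ∞} < 1

/-- The sets `S_n` and the function `V` witness Chen's condition for `q`: `V ≥ 0` is finite and
measurable, the measurable sets `S_n` increase to the whole space, the jump rates are bounded on
each `S_n`, `inf_{x ∉ S_n} V(x) → ∞` (with `inf ∅ = ∞`), and for some `α ∈ (0,∞)`,
`∫ V(y) q(dy|x) ≤ α V(x)` for all `x`, where the integral converges (as `V ≥ 0`, the only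
alternative is the value `∞`, which would violate the inequality). -/
structure ChenCondition (q : HomQFunction S) (Sn : ℕ → Set S) (V : S → ℝ) : Prop where
  measurable_V : Measurable V
  nonneg_V : ∀ x, 0 ≤ V x
  measurableSet_Sn : ∀ n, MeasurableSet (Sn n)
  monotone_Sn : Monotone Sn
  iUnion_Sn : ⋃ n, Sn n = univ
  bddAbove_rate : ∀ n, BddAbove (q.rate '' Sn n)
  tendsto_iInf : Tendsto (fun n => ⨅ x ∈ (Sn n)ᶜ, ENNReal.ofReal (V x)) atTop (𝓝 ∞)
  drift : ∃ α : ℝ, 0 < α ∧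
    ∀ x, (q x).Integrable V ∧ ∫ᵛ y, V y ∂<•(q x) ≤ α * V x

end HomQFunction

end

/-!
Fix `α > 0` and let `T u (x) = ∫ u(y) q̃(dy|x) / (α + q_x)` be the discounted jump operator, acting
on functions with values in `[0,∞]`. For a nonnegative integrable function `U`, the inequalities
`αU ≤ ∫ U(y) q(dy|x)` and `U ≤ T U` say the same, and likewise with `≥` or `=`. By the Markov
property, `Tⁿ 1 (x) = E_x e^{-α(θ₁ + ⋯ + θₙ)}` (`lintegral_prod_discount`), so the decreasing limit
`h = lim Tⁿ 1` is the Laplace transform `E_x e^{-α t_∞}` of the explosion time, and the process is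
nonexplosive if and only if `h = 0`, for one or for all `α > 0` (`nonexplosive_iff`). Everything else
is analysis of the operator `T`.

* `h = T h`, and every `u ≤ 1` with `u ≤ T u` satisfies `u ≤ Tⁿ 1` for all `n`, hence `u ≤ h`. So
  nonzero bounded solutions, or subsolutions, exist exactly when `h ≠ 0`.
* If Chen's condition holds, with `V ≥ m` off `S_n` and `q_x ≤ C` on `S_n`, then induction on `k`
  gives `T^k 1 ≤ V / m + (C / (α + C))^k`; hence `h ≤ V / m`, and `m` may be taken arbitrarily large
  (`explosionTransform_eq_zero_of_chen`).
* Conversely, on a locally compact space with Feller-type data, let `gₙ` be continuous, zero on the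
  `n`-th set `Kₙ` of a compact exhaustion and one off `Kₙ₊₁`. The functions `D₀ = 1`,
  `Dₙ₊₁ = max gₙ (T Dₙ)` are continuous, decrease in `n`, satisfy `T Dₙ ≤ Dₙ`, and equal `1` off
  `Kₙ`. Their limit `D` satisfies `D ≤ T D`, so it vanishes if `h = 0`, and by Dini's theorem the
  convergence is uniform on compact sets. The sum of a sparse subsequence of the `Dₙ` is then
  finite, bounded on each `Kₙ`, tends to infinity off the `Kₙ`, and satisfies the drift inequality
  (`exists_chenCondition`).
-/

namespace HomQFunction

/-! ### Integrals against `q(dy|x)` -/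

section VectorIntegral

variable {S : Type*} [MeasurableSpace S] [MeasurableSingletonClass S]

/-- `q(dy|x)` is the jump measure minus a point mass `q_x` at `x`. -/
theorem eq_jumpMeasure_add_dirac (q : HomQFunction S) (x : S) :
    q x = (q.jumpMeasure x).toSignedMeasure + VectorMeasure.dirac x (-q.rate x) := by
  ext Γ hΓ
  have hd : 0 ≤ q x (Γ \ {x}) :=
    q.nonneg_of_notMem x _ (hΓ.diff (measurableSet_singleton x)) (by simp)
  rw [add_apply, Measure.toSignedMeasure_apply_measurable hΓ, Measure.real,
    jumpMeasure_apply q x hΓ, ENNReal.toReal_ofReal hd]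
  by_cases hx : x ∈ Γ
  · have h := VectorMeasure.of_add_of_sdiff (v := q x) (measurableSet_singleton x) hΓ
      (singleton_subset_iff.2 hx)
    rw [VectorMeasure.dirac_apply_of_mem hΓ hx, rate]
    linarith
  · rw [VectorMeasure.dirac_apply_of_notMem hx, sdiff_singleton_eq_self hx, add_zero]

theorem integrable_vectorMeasure_dirac (x : S) (c : ℝ) (U : S → ℝ) :
    (VectorMeasure.dirac x c).Integrable U := by
  rw [VectorMeasure.Integrable, VectorMeasure.variation_dirac]
  refine Integrable.smul_measure ?_ (by simp)
  exact integrable_dirac (by simp)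

theorem integrable_of_jumpMeasure (q : HomQFunction S) (x : S) {U : S → ℝ}
    (h : Integrable U (q.jumpMeasure x)) : (q x).Integrable U := by
  have h1 : (q.jumpMeasure x).toSignedMeasure.Integrable U := by
    simpa [VectorMeasure.Integrable] using h
  have h2 := integrable_vectorMeasure_dirac x (-q.rate x) U
  rw [eq_jumpMeasure_add_dirac q x]
  exact (Integrable.add_measure h1 h2).mono_measure VectorMeasure.variation_add_le

theorem integrable_jumpMeasure (q : HomQFunction S) (x : S) {U : S → ℝ}
    (h : (q x).Integrable U) : Integrable U (q.jumpMeasure x) := by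
  have h2 := integrable_vectorMeasure_dirac x (-q.rate x) U
  have h3 : (q.jumpMeasure x).toSignedMeasure
      = q x - VectorMeasure.dirac x (-q.rate x) := by
    rw [eq_sub_iff_add_eq, ← eq_jumpMeasure_add_dirac]
  have h4 : (q.jumpMeasure x).toSignedMeasure.Integrable U := by
    rw [h3]
    exact (Integrable.add_measure h h2).mono_measure VectorMeasure.variation_sub_le
  simpa [VectorMeasure.Integrable] using h4

theorem integral_eq_jumpMeasure (q : HomQFunction S) (x : S) {U : S → ℝ}
    (h : Integrable U (q.jumpMeasure x)) :
    ∫ᵛ y, U y ∂<•(q x) = ∫ y, U y ∂(q.jumpMeasure x) - q.rate x * U x := by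
  have h1 : (q.jumpMeasure x).toSignedMeasure.Integrable U := by
    simpa [VectorMeasure.Integrable] using h
  have h2 := integrable_vectorMeasure_dirac x (-q.rate x) U
  rw [eq_jumpMeasure_add_dirac q x, VectorMeasure.integral_add_vectorMeasure h1 h2,
    VectorMeasure.integral_toSignedMeasure, VectorMeasure.integral_dirac]
  simp
  ring

theorem integrable_jumpMeasure_of_bounded (q : HomQFunction S) (x : S) {U : S → ℝ}
    (hU : Measurable U) {C : ℝ} (h0 : ∀ y, 0 ≤ U y) (hC : ∀ y, U y ≤ C) :
    Integrable U (q.jumpMeasure x) :=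
  Integrable.of_bound hU.aestronglyMeasurable C
    (ae_of_all _ fun y => by rw [Real.norm_of_nonneg (h0 y)]; exact hC y)

end VectorIntegral

/-! ### The discounted jump operator -/

section JumpOperator

variable {S : Type*} [MeasurableSpace S] [StandardBorelSpace S]

/-- The discounted jump operator `u ↦ ∫ u(y) q̃(dy|x) / (α + q_x)`, acting on functions with values
in `[0,∞]`: the expected value of `e^{-αθ₁} u(x₁)` for the process started at `x`, where
`u(x_∞)` is irrelevant because the discount factor vanishes at `θ₁ = ∞`. -/
noncomputable def jumpOp (q : HomQFunction S) (α : ℝ) (u : S → ℝ≥0∞) (x : S) : ℝ≥0∞ :=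
  (∫⁻ y, u y ∂(q.jumpMeasure x)) / ENNReal.ofReal (α + q.rate x)

variable (q : HomQFunction S) {α : ℝ}

theorem jumpOp_mono {u v : S → ℝ≥0∞} (h : u ≤ v) : q.jumpOp α u ≤ q.jumpOp α v := fun _ =>
  ENNReal.div_le_div_right (lintegral_mono h) _

theorem measurable_jumpOp {u : S → ℝ≥0∞} (hu : Measurable u) : Measurable (q.jumpOp α u) :=
  ((Measure.measurable_lintegral hu).comp q.measurable_jumpMeasure).div
    (q.measurable_rate.const_add α).ennreal_ofReal

theorem jumpOp_const (c : ℝ≥0∞) (x : S) :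
    q.jumpOp α (fun _ => c) x
      = c * (ENNReal.ofReal (q.rate x) / ENNReal.ofReal (α + q.rate x)) := by
  rw [jumpOp, lintegral_const, jumpMeasure_univ, mul_div_assoc]

theorem jumpOp_le_one (hα : 0 < α) {u : S → ℝ≥0∞} (hu : u ≤ 1) : q.jumpOp α u ≤ 1 := fun x =>
  (q.jumpOp_mono hu x).trans <| by
    change q.jumpOp α (fun _ => 1) x ≤ 1
    rw [jumpOp_const, one_mul]
    exact ENNReal.div_le_of_le_mul (by rw [one_mul]; exact ENNReal.ofReal_le_ofReal (by linarith))

theorem jumpOp_add {u v : S → ℝ≥0∞} (hu : Measurable u) (x : S) :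
    q.jumpOp α (fun y => u y + v y) x = q.jumpOp α u x + q.jumpOp α v x := by
  rw [jumpOp, lintegral_add_left hu, ENNReal.add_div]
  rfl

theorem jumpOp_div_const {u : S → ℝ≥0∞} (hu : Measurable u) (c : ℝ≥0∞) (x : S) :
    q.jumpOp α (fun y => u y / c) x = q.jumpOp α u x / c := by
  simp_rw [jumpOp, div_eq_mul_inv]
  rw [lintegral_mul_const _ hu]
  ring

theorem jumpOp_tsum {u : ℕ → S → ℝ≥0∞} (hu : ∀ n, Measurable (u n)) (x : S) :
    q.jumpOp α (fun y => ∑' n, u n y) x = ∑' n, q.jumpOp α (u n) x := by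
  simp_rw [jumpOp, div_eq_mul_inv]
  rw [lintegral_tsum fun n => (hu n).aemeasurable, ENNReal.tsum_mul_right]

/-- Continuity of the operator along decreasing sequences of functions bounded by `1`. -/
theorem jumpOp_iInf {u : ℕ → S → ℝ≥0∞} (hu : ∀ n, Measurable (u n)) (ha : Antitone u)
    (h1 : u 0 ≤ 1) (hα : 0 < α) (x : S) :
    q.jumpOp α (fun y => ⨅ n, u n y) x = ⨅ n, q.jumpOp α (u n) x := by
  have hpos : ENNReal.ofReal (α + q.rate x) ≠ 0 := by
    have := q.rate_nonneg x
    simp; linarith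
  have hfin : ∫⁻ y, u 0 y ∂(q.jumpMeasure x) ≠ ∞ := by
    refine ne_top_of_le_ne_top (b := ∫⁻ _, 1 ∂(q.jumpMeasure x)) ?_ (lintegral_mono h1)
    simp
  simp_rw [jumpOp]
  rw [lintegral_iInf hu ha hfin, ENNReal.iInf_div_of_ne hpos (by simp)]

/-- On nonnegative `q`-integrable functions, the operator is
`U ↦ (∫ U(y) q(dy|x) + q_x U(x)) / (α + q_x)`. -/
theorem jumpOp_ofReal {U : S → ℝ} (h0 : ∀ y, 0 ≤ U y) {x : S}
    (hi : Integrable U (q.jumpMeasure x)) (hα : 0 < α) :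
    q.jumpOp α (fun y => ENNReal.ofReal (U y)) x
      = ENNReal.ofReal ((∫ᵛ y, U y ∂<•(q x) + q.rate x * U x) / (α + q.rate x)) := by
  have := q.rate_nonneg x
  rw [jumpOp, ← ofReal_integral_eq_lintegral_ofReal hi (ae_of_all _ h0),
    integral_eq_jumpMeasure q x hi, ENNReal.ofReal_div_of_pos (by linarith), sub_add_cancel]

theorem integral_add_nonneg {U : S → ℝ} (h0 : ∀ y, 0 ≤ U y) {x : S}
    (hi : Integrable U (q.jumpMeasure x)) : 0 ≤ ∫ᵛ y, U y ∂<•(q x) + q.rate x * U x := by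
  rw [integral_eq_jumpMeasure q x hi, sub_add_cancel]
  exact integral_nonneg h0

theorem jumpOp_le_iff {U : S → ℝ} (h0 : ∀ y, 0 ≤ U y) {x : S}
    (hi : Integrable U (q.jumpMeasure x)) (hα : 0 < α) :
    q.jumpOp α (fun y => ENNReal.ofReal (U y)) x ≤ ENNReal.ofReal (U x)
      ↔ ∫ᵛ y, U y ∂<•(q x) ≤ α * U x := by
  have := q.rate_nonneg x
  rw [jumpOp_ofReal q h0 hi hα, ENNReal.ofReal_le_ofReal_iff (h0 x), div_le_iff₀ (by linarith),
    mul_add, mul_comm (U x), mul_comm (U x), add_le_add_iff_right]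

theorem le_jumpOp_iff {U : S → ℝ} (h0 : ∀ y, 0 ≤ U y) {x : S}
    (hi : Integrable U (q.jumpMeasure x)) (hα : 0 < α) :
    ENNReal.ofReal (U x) ≤ q.jumpOp α (fun y => ENNReal.ofReal (U y)) x
      ↔ α * U x ≤ ∫ᵛ y, U y ∂<•(q x) := by
  have := q.rate_nonneg x
  rw [jumpOp_ofReal q h0 hi hα, ENNReal.ofReal_le_ofReal_iff
      (div_nonneg (integral_add_nonneg q h0 hi) (by linarith)), le_div_iff₀ (by linarith),
    mul_add, mul_comm (U x), mul_comm (U x), add_le_add_iff_right]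

/-- The iterates `Tⁿ 1` of the discounted jump operator `T`; probabilistically,
`Tⁿ 1 (x) = E_x e^{-α(θ₁ + ⋯ + θₙ)}`. -/
noncomputable def jumpIter (q : HomQFunction S) (α : ℝ) : ℕ → S → ℝ≥0∞
  | 0 => 1
  | n + 1 => q.jumpOp α (jumpIter q α n)

theorem measurable_jumpIter (n : ℕ) : Measurable (q.jumpIter α n) := by
  induction n with
  | zero => exact measurable_const
  | succ n ih => exact q.measurable_jumpOp ih

theorem jumpIter_antitone (hα : 0 < α) : Antitone (q.jumpIter α) := by
  refine antitone_nat_of_succ_le fun n => ?_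
  induction n with
  | zero => exact q.jumpOp_le_one hα le_rfl
  | succ n ih => exact q.jumpOp_mono ih

/-- The limit `lim Tⁿ 1`, which is the Laplace transform `E_x e^{-α t_∞}` of the explosion time. -/
noncomputable def explosionTransform (q : HomQFunction S) (α : ℝ) (x : S) : ℝ≥0∞ := ⨅ n, q.jumpIter α n x

theorem measurable_explosionTransform : Measurable (q.explosionTransform α) :=
  Measurable.iInf q.measurable_jumpIter

theorem explosionTransform_le_one (x : S) : q.explosionTransform α x ≤ 1 := iInf_le _ 0

theorem jumpOp_explosionTransform (hα : 0 < α) (x : S) :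
    q.jumpOp α (q.explosionTransform α) x = q.explosionTransform α x := by
  have h := q.jumpOp_iInf q.measurable_jumpIter (q.jumpIter_antitone hα) le_rfl hα x
  refine h.trans ?_
  exact Antitone.iInf_nat_add (f := fun n => q.jumpIter α n x)
    (fun m n hmn => q.jumpIter_antitone hα hmn x) 1

/-- Maximality: the Laplace transform of the explosion time dominates every subsolution bounded
by `1`. -/
theorem le_explosionTransform {u : S → ℝ≥0∞} (h1 : u ≤ 1) (hu : u ≤ q.jumpOp α u) :
    u ≤ q.explosionTransform α := by
  have : ∀ n, u ≤ q.jumpIter α n := fun n => by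
    induction n with
    | zero => exact h1
    | succ n ih => exact hu.trans (q.jumpOp_mono ih)
  exact fun x => le_iInf fun n => this n x

end JumpOperator

/-! ### The Laplace transform of the explosion time -/

/-- The discount factor `e^{-αt}` for `t ∈ [0,∞]`, with `e^{-∞} = 0`. -/
noncomputable def discount (α : ℝ) (t : ℝ≥0∞) : ℝ≥0∞ :=
  (EReal.exp ((ENNReal.ofReal α * t : ℝ≥0∞) : EReal))⁻¹

theorem continuous_discount (α : ℝ) : Continuous (discount α) :=
  continuous_inv.comp <| ENNReal.continuous_exp.comp <| continuous_coe_ennreal_ereal.comp <|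
    ENNReal.continuous_const_mul ENNReal.ofReal_ne_top

theorem discount_zero (α : ℝ) : discount α 0 = 1 := by simp [discount]

theorem discount_add (α : ℝ) (s t : ℝ≥0∞) :
    discount α (s + t) = discount α s * discount α t := by
  rw [discount, mul_add, EReal.coe_ennreal_add, EReal.exp_add, ENNReal.mul_inv]
  · rfl
  · exact Or.inl (EReal.exp_eq_zero_iff.not.2 (EReal.coe_ennreal_ne_bot _))
  · exact Or.inr (EReal.exp_eq_zero_iff.not.2 (EReal.coe_ennreal_ne_bot _))

theorem discount_eq_zero_iff {α : ℝ} (hα : 0 < α) {t : ℝ≥0∞} : discount α t = 0 ↔ t = ∞ := by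
  rw [discount, ENNReal.inv_eq_zero, EReal.exp_eq_top_iff, EReal.coe_ennreal_eq_top_iff,
    ENNReal.mul_eq_top]
  simp [hα]

theorem discount_le_one (α : ℝ) (t : ℝ≥0∞) : discount α t ≤ 1 := by
  rw [discount, ENNReal.inv_le_one, EReal.one_le_exp_iff]
  exact EReal.coe_ennreal_nonneg _

theorem discount_ofReal {α t : ℝ} (hα : 0 < α) (ht : 0 ≤ t) :
    discount α (ENNReal.ofReal t) = ENNReal.ofReal (Real.exp (-(α * t))) := by
  rw [discount, ← ENNReal.ofReal_mul hα.le, EReal.coe_ennreal_ofReal, max_eq_left (by positivity),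
    EReal.exp_coe, ← ENNReal.ofReal_inv_of_pos (Real.exp_pos _), Real.exp_neg]

theorem discount_sum (α : ℝ) (t : ℕ → ℝ≥0∞) (n : ℕ) :
    discount α (∑ i ∈ Finset.range n, t i) = ∏ i ∈ Finset.range n, discount α (t i) := by
  induction n with
  | zero => simp [discount_zero]
  | succ n ih => rw [Finset.sum_range_succ, Finset.prod_range_succ, discount_add, ih]

theorem antitone_prod_discount (α : ℝ) (t : ℕ → ℝ≥0∞) :
    Antitone fun n => ∏ i ∈ Finset.range n, discount α (t i) :=
  antitone_nat_of_succ_le fun n => by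
    rw [Finset.prod_range_succ]
    exact mul_le_of_le_one_right' (discount_le_one _ _)

theorem discount_tsum (α : ℝ) (t : ℕ → ℝ≥0∞) :
    discount α (∑' i, t i) = ⨅ n, ∏ i ∈ Finset.range n, discount α (t i) := by
  refine tendsto_nhds_unique ?_ (tendsto_atTop_iInf (antitone_prod_discount α t))
  simp_rw [← discount_sum]
  exact ((continuous_discount α).tendsto _).comp (ENNReal.tendsto_nat_tsum t)

theorem lintegral_discount_expMeasure {α r : ℝ} (hα : 0 < α) (hr : 0 < r) :
    ∫⁻ t, discount α (ENNReal.ofReal t) ∂(expMeasure r)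
      = ENNReal.ofReal r / ENNReal.ofReal (α + r) := by
  have hp : 0 < α + r := by linarith
  have h : ∀ t, exponentialPDF r t * discount α (ENNReal.ofReal t)
      = ENNReal.ofReal (r / (α + r)) * exponentialPDF (α + r) t := fun t => by
    rcases lt_or_ge t 0 with ht | ht
    · simp [exponentialPDF_of_neg ht]
    · rw [exponentialPDF_of_nonneg ht, exponentialPDF_of_nonneg ht, discount_ofReal hα ht,
        ← ENNReal.ofReal_mul (by positivity), ← ENNReal.ofReal_mul (by positivity), mul_assoc,
        ← Real.exp_add]
      congr 1
      rw [← mul_assoc, div_mul_cancel₀ _ hp.ne']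
      ring_nf
  have hm : Measurable fun t : ℝ => discount α (ENNReal.ofReal t) :=
    (continuous_discount α).measurable.comp ENNReal.measurable_ofReal
  have hpdf : ∀ r, Measurable (exponentialPDF r) := fun r =>
    (measurable_exponentialPDFReal r).ennreal_ofReal
  have he : expMeasure r = volume.withDensity (exponentialPDF r) := rfl
  rw [he, lintegral_withDensity_eq_lintegral_mul _ (hpdf r) hm]
  simp only [Pi.mul_apply, h]
  rw [lintegral_const_mul _ (hpdf _), lintegral_exponentialPDF_eq_one hp, mul_one,
    ENNReal.ofReal_div_of_pos hp]

section Path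

variable {S : Type*} [MeasurableSpace S] [StandardBorelSpace S] (q : HomQFunction S) {α : ℝ}

theorem lintegral_discount_sojourn (hα : 0 < α) (x : S) :
    ∫⁻ t, discount α t ∂(q.sojourn x)
      = ENNReal.ofReal (q.rate x) / ENNReal.ofReal (α + q.rate x) := by
  by_cases h : q.rate x = 0
  · simp [sojourn, h, (discount_eq_zero_iff hα).2]
  · simp only [sojourn, Kernel.coe_mk, h, if_false]
    rw [lintegral_map (continuous_discount α).measurable ENNReal.measurable_ofReal]
    exact lintegral_discount_expMeasure hα ((q.rate_nonneg x).lt_of_ne' h)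

/-- One step of the chain, discounted by the sojourn time: this is the discounted jump operator on
functions of the state. The value at the cemetery plays no role. -/
theorem lintegral_step (hα : 0 < α) {u : S → ℝ≥0∞} (hu : Measurable u) (c : ℝ≥0∞)
    (p : (S ⊕ Unit) × ℝ≥0∞) :
    ∫⁻ y, discount α y.2 * Sum.elim u (fun _ => c) y.1 ∂(q.step p)
      = Sum.elim (q.jumpOp α u) (fun _ => 0) p.1 := by
  have hd := (continuous_discount α).measurable
  have hv : Measurable (Sum.elim u fun _ : Unit => c) := hu.sumElim measurable_const
  have hm : Measurable fun y : (S ⊕ Unit) × ℝ≥0∞ =>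
      discount α y.2 * Sum.elim u (fun _ => c) y.1 :=
    (hd.comp measurable_snd).mul (hv.comp measurable_fst)
  obtain ⟨x | _, t⟩ := p
  · change ∫⁻ y, _ ∂((q.postJump ×ₖ q.sojourn) x) = q.jumpOp α u x
    rw [Kernel.prod_apply, lintegral_prod _ hm.aemeasurable]
    simp_rw [lintegral_mul_const _ hd, lintegral_discount_sojourn q hα]
    rw [lintegral_const_mul _ hv]
    by_cases h : q.rate x = 0
    · have h0 : q.jumpMeasure x = 0 := by
        rw [← Measure.measure_univ_eq_zero, jumpMeasure_univ, h, ENNReal.ofReal_zero]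
      simp [jumpOp, h, h0]
    · have hpos := (q.rate_nonneg x).lt_of_ne' h
      simp only [postJump, Kernel.coe_mk, h, if_false]
      rw [lintegral_smul_measure, lintegral_map hv measurable_inl, smul_eq_mul, jumpOp]
      simp only [Sum.elim_inl, div_eq_mul_inv]
      rw [mul_comm (ENNReal.ofReal (q.rate x)), mul_assoc, ← mul_assoc (ENNReal.ofReal (q.rate x)),
        ENNReal.mul_inv_cancel (by simpa using hpos) (by simp), one_mul, mul_comm]
  · change ∫⁻ y, _ ∂(Measure.dirac _) = 0
    rw [lintegral_dirac' _ hm]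
    simp [(discount_eq_zero_iff hα).2]

/-- The expected discount factor at the `n`-th jump. -/
theorem lintegral_prod_discount (hα : 0 < α) (x : S) (n : ℕ) :
    ∫⁻ ω, ∏ i ∈ Finset.range n, discount α (ω (i + 1)).2 ∂(q.pathLaw x) = q.jumpIter α n x := by
  have hd := (continuous_discount α).measurable
  set κ : (n : ℕ) → Kernel (Finset.Iic n → (S ⊕ Unit) × ℝ≥0∞) ((S ⊕ Unit) × ℝ≥0∞) :=
    fun n => q.step.comap (fun h => h ⟨n, Finset.mem_Iic.2 le_rfl⟩) (measurable_pi_apply _) with hκ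
  -- the functionals `∏_{i ≤ n} e^{-αθ_i} u(x_n)`
  set F : ℕ → (S → ℝ≥0∞) → ℝ≥0∞ → (ℕ → (S ⊕ Unit) × ℝ≥0∞) → ℝ≥0∞ := fun n u c ω =>
    (∏ i ∈ Finset.range n, discount α (ω (i + 1)).2) * Sum.elim u (fun _ => c) (ω n).1 with hF
  have hFm : ∀ n u c, Measurable u → Measurable (F n u c) := fun n u c hu => by
    have hv : Measurable (Sum.elim u fun _ : Unit => c) := hu.sumElim measurable_const
    fun_prop
  -- one step of the chain turns `u` into the image of `u` under the discounted jump operator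
  have hstep : ∀ n u c, Measurable u → Kernel.lmarginalPartialTraj κ n (n + 1) (F (n + 1) u c)
      = F n (q.jumpOp α u) 0 := fun n u c hu => by
    ext ω
    rw [Kernel.lmarginalPartialTraj_succ _ (hFm _ _ _ hu)]
    change ∫⁻ y, _ ∂(q.step (ω n)) = _
    have : ∀ y, F (n + 1) u c (Function.update ω (n + 1) y)
        = (∏ i ∈ Finset.range n, discount α (ω (i + 1)).2) *
          (discount α y.2 * Sum.elim u (fun _ => c) y.1) := fun y => by
      simp only [hF, Finset.prod_range_succ, Function.update_self, mul_assoc]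
      congr 1
      refine Finset.prod_congr rfl fun i hi => ?_
      rw [Function.update_of_ne]
      have := Finset.mem_range.1 hi
      omega
    simp_rw [this]
    have hv : Measurable (Sum.elim u fun _ : Unit => c) := hu.sumElim measurable_const
    rw [lintegral_const_mul _ (by fun_prop), lintegral_step q hα hu]
  have hmarg : ∀ n k c (ω : ℕ → (S ⊕ Unit) × ℝ≥0∞), (ω 0).1 = Sum.inl x →
      Kernel.lmarginalPartialTraj κ 0 n (F n (q.jumpIter α k) c) ω
        = q.jumpIter α (n + k) x := fun n => by
    induction n with
    | zero =>
      intro k c ω hω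
      rw [Kernel.lmarginalPartialTraj_le _ le_rfl (hFm _ _ _ (q.measurable_jumpIter k)), zero_add]
      simp [hF, hω]
    | succ n ih =>
      intro k c ω hω
      rw [← Kernel.lmarginalPartialTraj_self n.zero_le n.le_succ
        (hFm _ _ _ (q.measurable_jumpIter k)), hstep _ _ _ (q.measurable_jumpIter k),
        Nat.succ_add, ← Nat.add_succ]
      exact ih (k + 1) 0 ω hω
  set ω₀ : ℕ → (S ⊕ Unit) × ℝ≥0∞ := fun _ => (Sum.inl x, 0) with hω₀
  have h₀ := hmarg n 0 1 ω₀ rfl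
  rw [add_zero] at h₀
  have hm : Measurable fun z => F n (q.jumpIter α 0) 1 (Function.updateFinset ω₀ (Finset.Iic n) z) :=
    (hFm _ _ _ (q.measurable_jumpIter 0)).comp measurable_updateFinset
  rw [← h₀, Kernel.lmarginalPartialTraj, ← Kernel.traj_map_frestrictLe_apply,
    lintegral_map hm (Preorder.measurable_frestrictLe n)]
  change ∫⁻ ω, _ ∂(q.pathLaw x) = ∫⁻ ω, _ ∂(q.pathLaw x)
  refine lintegral_congr fun ω => ?_
  have h1 : ∀ s : S ⊕ Unit, Sum.elim (q.jumpIter α 0) (fun _ => 1) s = 1 := by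
    rintro (s | s) <;> rfl
  simp only [hF, h1, mul_one]
  refine Finset.prod_congr rfl fun i hi => ?_
  have : i + 1 ≤ n := Finset.mem_range.1 hi
  simp [Function.updateFinset, this]

instance isProbabilityMeasure_pathLaw (x : S) : IsProbabilityMeasure (q.pathLaw x) := by
  unfold pathLaw
  infer_instance

omit [StandardBorelSpace S] in
theorem measurable_explosionTime : Measurable (explosionTime (S := S)) := by
  unfold explosionTime
  fun_prop

theorem lintegral_discount_explosionTime (hα : 0 < α) (x : S) :
    ∫⁻ ω, discount α (explosionTime ω) ∂(q.pathLaw x) = q.explosionTransform α x := by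
  have hd := (continuous_discount α).measurable
  simp_rw [explosionTime, discount_tsum, explosionTransform, ← lintegral_prod_discount q hα]
  refine lintegral_iInf (fun n => by fun_prop)
    (fun m n hmn ω => antitone_prod_discount α (fun i => (ω (i + 1)).2) hmn) ?_
  simp

theorem pathLaw_explosionTime_eq_one_iff (hα : 0 < α) (x : S) :
    q.pathLaw x {ω | explosionTime ω = ∞} = 1 ↔ q.explosionTransform α x = 0 := by
  have hm := measurable_explosionTime (S := S)
  have hdm : Measurable fun ω : ℕ → (S ⊕ Unit) × ℝ≥0∞ => discount α (explosionTime ω) :=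
    (continuous_discount α).measurable.comp hm
  have hs : MeasurableSet {ω : ℕ → (S ⊕ Unit) × ℝ≥0∞ | explosionTime ω = ∞} :=
    hm (measurableSet_singleton ∞)
  rw [← lintegral_discount_explosionTime q hα, lintegral_eq_zero_iff hdm,
    ← prob_compl_eq_zero_iff hs]
  simp only [Filter.EventuallyEq, Pi.zero_apply, discount_eq_zero_iff hα]
  rfl

/-- The process is nonexplosive if and only if the Laplace transform of the explosion time vanishes,
at any one `α > 0`. -/
theorem nonexplosive_iff (hα : 0 < α) : q.Nonexplosive ↔ q.explosionTransform α = 0 := by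
  simp_rw [Nonexplosive, pathLaw_explosionTime_eq_one_iff q hα, funext_iff, Pi.zero_apply]

theorem explosive_iff_not_nonexplosive : q.Explosive ↔ ¬ q.Nonexplosive := by
  simp_rw [Explosive, Nonexplosive, not_forall, prob_le_one.lt_iff_ne]

end Path

/-! ### Chen's condition forces the Laplace transform to vanish -/

section Sufficiency

variable {S : Type*} [MeasurableSpace S] [StandardBorelSpace S] (q : HomQFunction S) {α : ℝ}

/-- If `T v ≤ v`, with `v ≥ m` off a set `A` on which the jump rate is bounded by `C`, then
`Tⁿ 1 ≤ v / m + ρⁿ` for `ρ = C / (α + C)`: on `A` the operator `T` contracts constants by the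
factor `ρ`, and off `A` the first term is already at least `1`. -/
theorem jumpIter_le_add_pow (hα : 0 < α) {v : S → ℝ≥0∞} (hv : Measurable v)
    (hTv : q.jumpOp α v ≤ v) {A : Set S} {C : ℝ} (hC : ∀ x ∈ A, q.rate x ≤ C) {m : ℝ≥0∞}
    (hm0 : m ≠ 0) (hmtop : m ≠ ∞) (hm : ∀ x ∉ A, m ≤ v x) (n : ℕ) (x : S) :
    q.jumpIter α n x ≤ v x / m + ENNReal.ofReal (C / (α + C)) ^ n := by
  induction n generalizing x with
  | zero => rw [pow_zero]; exact le_add_self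
  | succ n ih =>
    by_cases hx : x ∈ A
    · have h0 := q.rate_nonneg x
      have hρ : ENNReal.ofReal (q.rate x) / ENNReal.ofReal (α + q.rate x)
          ≤ ENNReal.ofReal (C / (α + C)) := by
        rw [← ENNReal.ofReal_div_of_pos (by linarith)]
        refine ENNReal.ofReal_le_ofReal ?_
        have := hC x hx
        rw [div_le_div_iff₀ (by linarith) (by linarith)]
        nlinarith
      calc q.jumpOp α (q.jumpIter α n) x
          ≤ q.jumpOp α (fun y => v y / m + ENNReal.ofReal (C / (α + C)) ^ n) x :=
            q.jumpOp_mono ih x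
        _ = q.jumpOp α v x / m + ENNReal.ofReal (C / (α + C)) ^ n *
              (ENNReal.ofReal (q.rate x) / ENNReal.ofReal (α + q.rate x)) := by
            rw [jumpOp_add q (hv.div_const m), jumpOp_div_const q hv, jumpOp_const]
        _ ≤ v x / m + ENNReal.ofReal (C / (α + C)) ^ (n + 1) := by
            rw [pow_succ]
            gcongr
            exact hTv x
    · refine (q.jumpIter_antitone hα (Nat.zero_le (n + 1)) x).trans (le_add_right ?_)
      change 1 ≤ v x / m
      rw [ENNReal.le_div_iff_mul_le (Or.inl hm0) (Or.inl hmtop), one_mul]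
      exact hm x hx

theorem explosionTransform_le_div (hα : 0 < α) {v : S → ℝ≥0∞} (hv : Measurable v)
    (hTv : q.jumpOp α v ≤ v) {A : Set S} {C : ℝ} (hC : ∀ x ∈ A, q.rate x ≤ C) {m : ℝ≥0∞}
    (hm0 : m ≠ 0) (hmtop : m ≠ ∞) (hm : ∀ x ∉ A, m ≤ v x) (x : S) :
    q.explosionTransform α x ≤ v x / m := by
  have hC' : ∀ x ∈ A, q.rate x ≤ max C 0 := fun x hx => (hC x hx).trans (le_max_left _ _)
  have hlt : ENNReal.ofReal (max C 0 / (α + max C 0)) < 1 := by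
    have : 0 ≤ max C 0 := le_max_right _ _
    rw [ENNReal.ofReal_lt_one, div_lt_one (by linarith)]
    linarith
  have hlim : Tendsto (fun n => v x / m + ENNReal.ofReal (max C 0 / (α + max C 0)) ^ n) atTop
      (𝓝 (v x / m + 0)) :=
    (ENNReal.tendsto_pow_atTop_nhds_zero_of_lt_one hlt).const_add _
  rw [add_zero] at hlim
  exact ge_of_tendsto' hlim fun n =>
    (iInf_le _ n).trans (q.jumpIter_le_add_pow hα hv hTv hC' hm0 hmtop hm n x)

theorem explosionTransform_eq_zero_of_chen {Sn : ℕ → Set S} {V : S → ℝ}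
    (h : q.ChenCondition Sn V) : ∃ α > 0, q.explosionTransform α = 0 := by
  obtain ⟨α, hα, hdrift⟩ := h.drift
  refine ⟨α, hα, funext fun x => ?_⟩
  have hTv : q.jumpOp α (fun y => ENNReal.ofReal (V y)) ≤ fun y => ENNReal.ofReal (V y) :=
    fun y => (q.jumpOp_le_iff h.nonneg_V (integrable_jumpMeasure q y (hdrift y).1) hα).2
      (hdrift y).2
  have key : ∀ k : ℕ, q.explosionTransform α x ≤ ENNReal.ofReal (V x) / ((k + 1 : ℕ) : ℝ≥0∞) :=
    fun k => by
      obtain ⟨n, hn⟩ :=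
        ((ENNReal.tendsto_nhds_top_iff_nat.1 h.tendsto_iInf) (k + 1)).exists
      obtain ⟨C, hC⟩ := h.bddAbove_rate n
      exact q.explosionTransform_le_div hα h.measurable_V.ennreal_ofReal hTv
        (A := Sn n) (C := C) (fun y hy => hC ⟨y, hy, rfl⟩) (by simp) (by simp)
        (fun y hy => hn.le.trans (iInf₂_le y hy)) x
  have hlim : Tendsto (fun k : ℕ => ENNReal.ofReal (V x) / ((k + 1 : ℕ) : ℝ≥0∞)) atTop
      (𝓝 (ENNReal.ofReal (V x) / ∞)) :=
    ENNReal.Tendsto.const_div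
      ((tendsto_add_atTop_iff_nat 1).2 ENNReal.tendsto_nat_nhds_top) (by simp)
  rw [ENNReal.div_top] at hlim
  exact le_antisymm (ge_of_tendsto' hlim key) bot_le

end Sufficiency

/-! ### Construction of the Lyapunov function -/

/-- Continuous functions that vanish on the `n`-th set of a compact exhaustion and equal `1` off
the next one. They decrease in `n`. -/
theorem exists_cutoff {S : Type*} [TopologicalSpace S] [TopologicalSpace.MetrizableSpace S]
    (K : CompactExhaustion S) :
    ∃ g : ℕ → S → ℝ≥0∞, (∀ n, Continuous (g n)) ∧ (∀ n, g n ≤ 1) ∧ Antitone g ∧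
      (∀ n, ∀ x ∈ K n, g n x = 0) ∧ ∀ n, ∀ x ∉ K (n + 1), g n x = 1 := by
  have h : ∀ n, ∃ f : C(S, ℝ), EqOn f 0 (K n) ∧ EqOn f 1 (interior (K (n + 1)))ᶜ ∧
      ∀ x, f x ∈ Icc (0 : ℝ) 1 := fun n =>
    exists_continuous_zero_one_of_isClosed (K.isCompact n).isClosed isOpen_interior.isClosed_compl
      (disjoint_compl_right_iff_subset.2 (K.subset_interior_succ n))
  choose f hf0 hf1 hf using h
  have hle : ∀ n x, ENNReal.ofReal (f n x) ≤ 1 := fun n x =>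
    ENNReal.ofReal_le_one.2 (hf n x).2
  have h1 : ∀ n, ∀ x ∉ K (n + 1), ENNReal.ofReal (f n x) = 1 := fun n x hx => by
    rw [hf1 n fun h => hx (interior_subset h)]
    simp
  refine ⟨fun n x => ENNReal.ofReal (f n x),
    fun n => ENNReal.continuous_ofReal.comp (f n).continuous, hle,
    antitone_nat_of_succ_le fun n x => ?_, fun n x hx => ?_, h1⟩
  · by_cases hx : x ∈ K (n + 1)
    · simp [hf0 (n + 1) hx]
    · change _ ≤ ENNReal.ofReal (f n x)
      rw [h1 n x hx]
      exact hle _ _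
  · simp [hf0 n hx]

section CutoffIteration

variable {S : Type*} [MeasurableSpace S] [StandardBorelSpace S] (q : HomQFunction S) {α : ℝ}
  {g : ℕ → S → ℝ≥0∞}

/-- Continuous approximations from above of the Laplace transform of the explosion time: with `T`
the discounted jump operator, `D₀ = 1` and `Dₙ₊₁ = max gₙ (T Dₙ)`, where `gₙ` is a cutoff that
vanishes on larger and larger compact sets. -/
noncomputable def cutoffIter (q : HomQFunction S) (α : ℝ) (g : ℕ → S → ℝ≥0∞) : ℕ → S → ℝ≥0∞
  | 0 => 1
  | n + 1 => g n ⊔ q.jumpOp α (cutoffIter q α g n)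

theorem cutoffIter_le_one (hα : 0 < α) (hg1 : ∀ n, g n ≤ 1) (n : ℕ) : q.cutoffIter α g n ≤ 1 := by
  induction n with
  | zero => exact le_rfl
  | succ n ih => exact sup_le (hg1 n) (q.jumpOp_le_one hα ih)

theorem cutoffIter_antitone (hα : 0 < α) (hg1 : ∀ n, g n ≤ 1) (hg : Antitone g) :
    Antitone (q.cutoffIter α g) := by
  refine antitone_nat_of_succ_le fun n => ?_
  induction n with
  | zero => exact q.cutoffIter_le_one hα hg1 1
  | succ n ih => exact sup_le_sup (hg n.le_succ) (q.jumpOp_mono ih)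

theorem jumpOp_cutoffIter_le (hα : 0 < α) (hg1 : ∀ n, g n ≤ 1) (hg : Antitone g) (n : ℕ) :
    q.jumpOp α (q.cutoffIter α g n) ≤ q.cutoffIter α g n :=
  le_sup_right.trans (q.cutoffIter_antitone hα hg1 hg n.le_succ)

theorem iInf_cutoffIter_le (hα : 0 < α) (hg1 : ∀ n, g n ≤ 1) (hg : Antitone g)
    (hm : ∀ n, Measurable (q.cutoffIter α g n)) (hg0 : ∀ x, ∀ᶠ n in atTop, g n x = 0) :
    (fun x => ⨅ n, q.cutoffIter α g n x) ≤ q.explosionTransform α := by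
  have ha := q.cutoffIter_antitone hα hg1 hg
  refine q.le_explosionTransform (fun x => iInf_le _ 0) fun x => ?_
  rw [q.jumpOp_iInf hm ha le_rfl hα]
  refine le_iInf fun n => ?_
  obtain ⟨k, hk, hnk⟩ := ((hg0 x).and (eventually_ge_atTop n)).exists
  refine (iInf_le _ (k + 1)).trans ?_
  change g k x ⊔ q.jumpOp α (q.cutoffIter α g k) x ≤ _
  rw [hk]
  exact sup_le bot_le (q.jumpOp_mono (ha hnk) x)

end CutoffIteration

section Necessity

variable {S : Type*} [TopologicalSpace S] [TopologicalSpace.MetrizableSpace S]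
  [MeasurableSpace S] [BorelSpace S] [StandardBorelSpace S] (q : HomQFunction S) {α : ℝ}
  {g : ℕ → S → ℝ≥0∞}

omit [TopologicalSpace.MetrizableSpace S] in
/-- Under the Feller-type hypotheses, the discounted jump operator preserves continuity. -/
theorem continuous_jumpOp (hα : 0 < α) (hrate : Continuous q.rate)
    (hfeller : ∀ f : S →ᵇ ℝ, Continuous fun x => ∫ᵛ y, f y ∂<•(q x)) {u : S → ℝ≥0∞}
    (hu : Continuous u) (h1 : u ≤ 1) : Continuous (q.jumpOp α u) := by
  have htop : ∀ x, u x ≠ ∞ := fun x => ((h1 x).trans_lt ENNReal.one_lt_top).ne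
  have hU : Continuous fun x => (u x).toReal := ENNReal.continuousOn_toReal.comp_continuous hu htop
  have hle : ∀ x, (u x).toReal ≤ 1 := fun x => ENNReal.toReal_mono ENNReal.one_ne_top (h1 x)
  have h0 : ∀ x, 0 ≤ (u x).toReal := fun x => ENNReal.toReal_nonneg
  have heq : q.jumpOp α u = fun x => ENNReal.ofReal
      ((∫ᵛ y, (u y).toReal ∂<•(q x) + q.rate x * (u x).toReal) / (α + q.rate x)) := by
    ext x
    rw [← q.jumpOp_ofReal h0 (q.integrable_jumpMeasure_of_bounded x hU.measurable h0 hle) hα]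
    simp_rw [ENNReal.ofReal_toReal (htop _)]
  rw [heq]
  refine ENNReal.continuous_ofReal.comp (Continuous.div ?_ (hrate.const_add α)
    fun x => by have := q.rate_nonneg x; linarith)
  refine Continuous.add ?_ (hrate.mul hU)
  exact hfeller (BoundedContinuousFunction.ofNormedAddCommGroup _ hU 1 fun x => by
    rw [Real.norm_of_nonneg (h0 x)]; exact hle x)

omit [TopologicalSpace.MetrizableSpace S] in
theorem continuous_cutoffIter (hα : 0 < α) (hrate : Continuous q.rate)
    (hfeller : ∀ f : S →ᵇ ℝ, Continuous fun x => ∫ᵛ y, f y ∂<•(q x))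
    (hg1 : ∀ n, g n ≤ 1) (hgc : ∀ n, Continuous (g n)) (n : ℕ) :
    Continuous (q.cutoffIter α g n) := by
  induction n with
  | zero => exact continuous_const
  | succ n ih =>
    exact (hgc n).sup (q.continuous_jumpOp hα hrate hfeller ih (q.cutoffIter_le_one hα hg1 n))

/-- If the Laplace transform of the explosion time vanishes at `α`, then, by Dini's theorem, the
continuous approximations `D_n` tend to `0` uniformly on compact sets, and the sum of a sparse
subsequence of them is the function `V` in Chen's condition. -/
theorem exists_chenCondition [SecondCountableTopology S] [LocallyCompactSpace S]
    (hrate : Continuous q.rate)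
    (hfeller : ∀ f : S →ᵇ ℝ, Continuous fun x => ∫ᵛ y, f y ∂<•(q x)) (hα : 0 < α)
    (hzero : q.explosionTransform α = 0) :
    ∃ (Sn : ℕ → Set S) (V : S → ℝ), q.ChenCondition Sn V ∧
      (∀ n, IsCompact (Sn n)) ∧ ∀ n, BddAbove (V '' Sn n) := by
  let K : CompactExhaustion S := default
  have hKmono : Monotone K := fun m n hmn => K.subset hmn
  obtain ⟨g, hgc, hg1, hg, hg0, hgone⟩ := exists_cutoff K
  set D := q.cutoffIter α g with hD
  have hDc : ∀ n, Continuous (D n) := q.continuous_cutoffIter hα hrate hfeller hg1 hgc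
  have hDa : Antitone D := q.cutoffIter_antitone hα hg1 hg
  have hD1 : ∀ n, D n ≤ 1 := q.cutoffIter_le_one hα hg1
  have hTD : ∀ n, q.jumpOp α (D n) ≤ D n := q.jumpOp_cutoffIter_le hα hg1 hg
  have hDtop : ∀ n x, D n x ≠ ∞ := fun n x => ((hD1 n x).trans_lt ENNReal.one_lt_top).ne
  have hDone : ∀ m x, x ∉ K m → ∀ n ≤ m, D n x = 1 := fun m x hx n hn => by
    cases n with
    | zero => rfl
    | succ n =>
      refine le_antisymm (hD1 _ x) ?_
      rw [← hgone n x fun h => hx (hKmono hn h)]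
      exact le_sup_left (a := g n x)
  have hDlim : ∀ x, Tendsto (fun n => (D n x).toReal) atTop (𝓝 0) := fun x => by
    have h0 : ⨅ n, D n x = 0 := by
      have hle := q.iInf_cutoffIter_le hα hg1 hg (fun n => (hDc n).measurable) (fun x => by
        obtain ⟨m, hm⟩ := K.exists_mem x
        filter_upwards [eventually_ge_atTop m] with n hn using hg0 n x (hKmono hn hm)) x
      rw [hzero] at hle
      exact le_antisymm hle bot_le
    have := tendsto_atTop_iInf (f := fun n => D n x) fun m n hmn => hDa hmn x
    rw [h0] at this
    exact (ENNReal.tendsto_toReal ENNReal.zero_ne_top).comp this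
  have hunif : ∀ k : ℕ, ∀ᶠ n in atTop, ∀ x ∈ K k, D n x ≤ (2⁻¹ : ℝ≥0∞) ^ k := fun k => by
    have h := Antitone.tendstoUniformlyOn_of_forall_tendsto (K.isCompact k)
      (F := fun n x => (D n x).toReal) (f := fun _ => 0)
      (fun n => (ENNReal.continuousOn_toReal.comp_continuous (hDc n) (hDtop n)).continuousOn)
      (fun x _ m n hmn => ENNReal.toReal_mono (hDtop m x) (hDa hmn x))
      continuousOn_const (fun x _ => hDlim x)
    filter_upwards [Metric.tendstoUniformlyOn_iff.1 h ((2⁻¹ : ℝ) ^ k) (by positivity)] with n hn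
    intro x hx
    have h1 := hn x hx
    rw [Real.dist_eq, zero_sub, abs_neg, abs_of_nonneg ENNReal.toReal_nonneg] at h1
    rw [← ENNReal.ofReal_toReal (hDtop n x)]
    refine (ENNReal.ofReal_le_ofReal h1.le).trans_eq ?_
    rw [ENNReal.ofReal_pow (by norm_num), ENNReal.ofReal_inv_of_pos (by norm_num)]
    norm_num
  obtain ⟨φ, hφ, hφK⟩ := extraction_forall_of_eventually hunif
  set W : S → ℝ≥0∞ := fun x => ∑' k, D (φ k) x with hW
  have hWm : Measurable W := Measurable.tsum fun k => (hDc (φ k)).measurable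
  -- on the `j`-th compact set all but the first `j` terms are dominated by a geometric series
  have hWK : ∀ j, ∀ x ∈ K j, W x ≤ j + 2 := fun j x hx => by
    have hterm : ∀ k, D (φ k) x ≤ (if k ∈ Finset.range j then 1 else 0) + (2⁻¹ : ℝ≥0∞) ^ k :=
      fun k => by
        split_ifs with hk
        · exact le_add_right (hD1 _ x)
        · rw [zero_add]
          exact hφK k x (hKmono (not_lt.1 fun h => hk (Finset.mem_range.2 h)) hx)
    refine (ENNReal.tsum_le_tsum hterm).trans_eq ?_
    rw [ENNReal.tsum_add, ENNReal.tsum_geometric, tsum_eq_sum (s := Finset.range j) (by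
      intro b hb; rw [if_neg hb]), Finset.sum_congr rfl fun k hk => if_pos hk]
    simp
  have hWtop : ∀ x, W x ≠ ∞ := fun x => by
    obtain ⟨j, hj⟩ := K.exists_mem x
    exact ne_top_of_le_ne_top (by finiteness) (hWK j x hj)
  have hTW : q.jumpOp α W ≤ W := fun x => by
    rw [hW, q.jumpOp_tsum fun k => (hDc (φ k)).measurable]
    exact ENNReal.tsum_le_tsum fun k => hTD (φ k) x
  have hofReal : (fun x => ENNReal.ofReal (W x).toReal) = W :=
    funext fun x => ENNReal.ofReal_toReal (hWtop x)
  refine ⟨K, fun x => (W x).toReal, ⟨hWm.ennreal_toReal, fun x => ENNReal.toReal_nonneg,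
    fun n => (K.isCompact n).measurableSet, hKmono, K.iUnion_eq,
    fun n => (K.isCompact n).bddAbove_image hrate.continuousOn, ?_, α, hα, fun x => ?_⟩,
    K.isCompact, fun n => ⟨n + 2, ?_⟩⟩
  · refine ENNReal.tendsto_nhds_top fun N => ?_
    filter_upwards [eventually_ge_atTop (φ (N + 1))] with m hm
    refine lt_of_lt_of_le (b := ((N + 1 : ℕ) : ℝ≥0∞)) (by exact_mod_cast N.lt_succ_self) ?_
    refine le_iInf₂ fun x hx => ?_
    rw [ENNReal.ofReal_toReal (hWtop x)]
    calc ((N + 1 : ℕ) : ℝ≥0∞) = ∑ k ∈ Finset.range (N + 1), D (φ k) x := by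
          rw [Finset.sum_congr rfl fun k hk => hDone m x hx (φ k)
            ((hφ.monotone (Finset.mem_range.1 hk).le).trans hm)]
          simp
      _ ≤ W x := ENNReal.sum_le_tsum _
  · have hint : Integrable (fun y => (W y).toReal) (q.jumpMeasure x) := by
      refine integrable_toReal_of_lintegral_ne_top hWm.aemeasurable fun htop => ?_
      have h := hTW x
      rw [jumpOp, htop, ENNReal.top_div_of_ne_top ENNReal.ofReal_ne_top, top_le_iff] at h
      exact hWtop x h
    refine ⟨integrable_of_jumpMeasure q x hint, ?_⟩
    rw [← q.jumpOp_le_iff (fun y => ENNReal.toReal_nonneg) hint hα, hofReal,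
      ENNReal.ofReal_toReal (hWtop x)]
    exact hTW x
  · rintro _ ⟨x, hx, rfl⟩
    have h := ENNReal.toReal_mono (by finiteness) (hWK n x hx)
    rwa [ENNReal.toReal_add (by simp) (by simp), ENNReal.toReal_natCast, ENNReal.toReal_ofNat] at h

end Necessity

/-! ### Bounded solutions of the drift inequality -/

section ZeroExit

variable {S : Type*} [MeasurableSpace S] [StandardBorelSpace S] (q : HomQFunction S) {α : ℝ}

/-- A nonzero bounded nonnegative subsolution of `αU = ∫ U(y) q(dy|x)` rules out nonexplosion:
scaled to be at most `1`, it lies below the Laplace transform of the explosion time. -/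
theorem not_nonexplosive_of_subsolution (hα : 0 < α) {U : S → ℝ} (hU : Measurable U)
    (h0 : ∀ x, 0 ≤ U x) (hb : BddAbove (range U)) (hne : ∃ x, U x ≠ 0)
    (hle : ∀ x, α * U x ≤ ∫ᵛ y, U y ∂<•(q x)) : ¬ q.Nonexplosive := by
  intro hq
  rw [nonexplosive_iff q hα] at hq
  obtain ⟨C, hC⟩ := hb
  obtain ⟨x₀, hx₀⟩ := hne
  have hUC : ∀ x, U x ≤ C := fun x => hC ⟨x, rfl⟩
  have hUpos : 0 < U x₀ := (h0 x₀).lt_of_ne' hx₀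
  have hCpos : 0 < C := hUpos.trans_le (hUC x₀)
  have hsub := q.le_explosionTransform (α := α)
    (u := fun x => ENNReal.ofReal (U x) / ENNReal.ofReal C)
    (fun x => ENNReal.div_le_of_le_mul (by
      rw [Pi.one_apply, one_mul]
      exact ENNReal.ofReal_le_ofReal (hUC x)))
    (fun x => by
      rw [jumpOp_div_const q hU.ennreal_ofReal]
      exact ENNReal.div_le_div_right ((q.le_jumpOp_iff h0
        (q.integrable_jumpMeasure_of_bounded x hU h0 hUC) hα).2 (hle x)) _) x₀
  rw [hq, Pi.zero_apply, nonpos_iff_eq_zero, ENNReal.div_eq_zero_iff] at hsub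
  rcases hsub with h | h
  · exact absurd (ENNReal.ofReal_eq_zero.1 h) (not_le.2 hUpos)
  · exact ENNReal.ofReal_ne_top h

/-- If the process is explosive, the Laplace transform of the explosion time is a nonzero solution
of `αU = ∫ U(y) q(dy|x)` with values in `[0,1]`. -/
theorem exists_solution_of_not_nonexplosive (hα : 0 < α) (hq : ¬ q.Nonexplosive) :
    ∃ U : S → ℝ, Measurable U ∧ (∀ x, U x ∈ Icc (0 : ℝ) 1) ∧ (∃ x, U x ≠ 0) ∧
      ∀ x, α * U x = ∫ᵛ y, U y ∂<•(q x) := by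
  have h1 := q.explosionTransform_le_one (α := α)
  have htop : ∀ x, q.explosionTransform α x ≠ ∞ := fun x =>
    ((h1 x).trans_lt ENNReal.one_lt_top).ne
  have hU : Measurable fun x => (q.explosionTransform α x).toReal :=
    q.measurable_explosionTransform.ennreal_toReal
  have h0 : ∀ x, 0 ≤ (q.explosionTransform α x).toReal := fun x => ENNReal.toReal_nonneg
  have hle : ∀ x, (q.explosionTransform α x).toReal ≤ 1 := fun x =>
    ENNReal.toReal_mono ENNReal.one_ne_top (h1 x)
  have hofReal : (fun x => ENNReal.ofReal (q.explosionTransform α x).toReal)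
      = q.explosionTransform α := funext fun x => ENNReal.ofReal_toReal (htop x)
  refine ⟨_, hU, fun x => ⟨h0 x, hle x⟩, ?_, fun x => ?_⟩
  · rw [nonexplosive_iff q hα, funext_iff, not_forall] at hq
    obtain ⟨x, hx⟩ := hq
    exact ⟨x, ENNReal.toReal_ne_zero.2 ⟨hx, htop x⟩⟩
  · have hint := q.integrable_jumpMeasure_of_bounded x hU h0 hle
    have hfix := q.jumpOp_explosionTransform hα x
    refine le_antisymm ?_ ?_
    · rw [← q.le_jumpOp_iff h0 hint hα, hofReal, ENNReal.ofReal_toReal (htop x)]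
      exact hfix.ge
    · rw [← q.jumpOp_le_iff h0 hint hα, hofReal, ENNReal.ofReal_toReal (htop x)]
      exact hfix.le

end ZeroExit

end HomQFunction

theorem theorem3p3 {S : Type*} [TopologicalSpace S] [TopologicalSpace.MetrizableSpace S]
    [SecondCountableTopology S] [MeasurableSpace S] [BorelSpace S] [StandardBorelSpace S]
    [Nonempty S] (q : HomQFunction S) :
    -- (a) Chen's condition implies nonexplosion
    ((∃ (Sn : ℕ → Set S) (V : S → ℝ), q.ChenCondition Sn V) → q.Nonexplosive) ∧
    -- (b) necessity of Chen's condition on locally compact spaces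
    (LocallyCompactSpace S → Continuous q.rate →
      (∀ f : S →ᵇ ℝ, Continuous fun x => ∫ᵛ y, f y ∂<•(q x)) →
      q.Nonexplosive →
      ∃ (Sn : ℕ → Set S) (V : S → ℝ), q.ChenCondition Sn V ∧
        (∀ n, IsCompact (Sn n)) ∧ ∀ n, BddAbove (V '' Sn n)) ∧
    -- (c) zero-exit characterization of nonexplosion
    (q.Nonexplosive ↔
      ∀ α : ℝ, 0 < α → ¬ ∃ U : S → ℝ, Measurable U ∧ (∀ x, U x ∈ Icc (0 : ℝ) 1) ∧
        (∃ x, U x ≠ 0) ∧ ∀ x, α * U x = ∫ᵛ y, U y ∂<•(q x)) ∧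
    -- (d) characterization of explosion
    (q.Explosive ↔
      ∃ (U : S → ℝ) (α : ℝ), Measurable U ∧ (∀ x, 0 ≤ U x) ∧ BddAbove (range U) ∧
        (∃ x, U x ≠ 0) ∧ 0 < α ∧ ∀ x, α * U x ≤ ∫ᵛ y, U y ∂<•(q x)) := by
  refine ⟨?_, ?_, ?_, ?_⟩
  · rintro ⟨Sn, V, h⟩
    obtain ⟨α, hα, hzero⟩ := q.explosionTransform_eq_zero_of_chen h
    exact (q.nonexplosive_iff hα).2 hzero
  · intro _ hrate hfeller hq
    exact q.exists_chenCondition hrate hfeller one_pos ((q.nonexplosive_iff one_pos).1 hq)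
  · constructor
    · rintro hq α hα ⟨U, hU, hU01, hne, heq⟩
      exact q.not_nonexplosive_of_subsolution hα hU (fun x => (hU01 x).1)
        ⟨1, by rintro _ ⟨x, rfl⟩; exact (hU01 x).2⟩ hne (fun x => (heq x).le) hq
    · intro h
      by_contra hq
      exact h 1 one_pos (q.exists_solution_of_not_nonexplosive one_pos hq)
  · rw [q.explosive_iff_not_nonexplosive]
    constructor
    · intro hq
      obtain ⟨U, hU, hU01, hne, heq⟩ := q.exists_solution_of_not_nonexplosive one_pos hq
      exact ⟨U, 1, hU, fun x => (hU01 x).1, ⟨1, by rintro _ ⟨x, rfl⟩; exact (hU01 x).2⟩, hne,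
        one_pos, fun x => (heq x).le⟩
    · rintro ⟨U, α, hU, h0, hb, hne, hα, hle⟩
      exact q.not_nonexplosive_of_subsolution hα hU h0 hb hne hle
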